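/- **Notation.** For $n\ge 0$ let $\mathrm{Conf}_n(\mathbb C)$ be the space of $n$-tuples of pairwise distinct complex numbers, and let $PB_n=\pi_1(\mathrm{Conf}_n(\mathbb C),(0,1,\dots,n-1))$ be the pure braid group on $n$ strands. Given integers $k_1,\dots,k_n\ge 0$ and $m=\sum_i k_i$, let $\sigma\mapsto\sigma\langle k_1,\dots,k_n\rangle$, $PB_n\to PB_m$, be the block braid map, replacing the $i$-th strand by $k_i$ parallel copies of it, and let $(\tau_i)_i\mapsto\tau_1\oplus\dots\oplus\tau_n$, $\prod_i PB_{k_i}\to PB_m$, be the juxtaposition of braids. The operadic (cabling) composition is $$\gamma\colon PB_n\times\prod_{i=1}^n PB_{k_i}\to PB_m,\qquad \gamma(\sigma;\tau_1,\dots,\tau_n)=\sigma\langle k_1,\dots,k_n\rangle\cdot(\tau_1\oplus\dots\oplus\tau_n).$$ Let $\mathcal T$ be a finite rooted tree with levels $J_{p+1}=\{\ast\}$ (the root), $J_p,\dots,J_1$ (the leaves), each node of $J_l$ having its parent in $J_{l+1}$, and with ordered sets of child-nodes, so that each level is listed from left to right; let $k_i$ be the number of child-nodes of the node $i$. Set $PB(\mathcal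 T)_{p+1}=PB_1$ and, for $l=p,\dots,1$, $$PB(\mathcal T)_l=\gamma\Bigl(PB(\mathcal T)_{l+1}\times\prod_{i\in J_{l+1}}PB_{k_i}\Bigr)\subseteq PB_{|J_l|},\qquad PB(\mathcal T)=PB(\mathcal T)_1\subseteq PB_{|J_1|}.$$ Let $n,p\ge 0$ and let $\mathfrak t\subset\mathbb C^{n+1}$ be the space of vectors with coordinate sum zero, i.e. the standard Cartan subalgebra of $\mathfrak{sl}_{n+1}(\mathbb C)$, with roots $\alpha_{ij}(v)=v_i-v_j$ for $i\ne j$. An irregular type is a polynomial $Q=\sum_{l=1}^p A_l x^l$ with $A_l\in\mathfrak t$. Put $d_\alpha=\deg_x\alpha(Q)$, with $\deg 0=0$; let $$\mathbf B_Q=\Bigl\{(A'_1,\dots,A'_p)\in\mathfrak t^p\;:\;\deg_x\alpha\Bigl(\sum_l A'_lx^l\Bigr)=d_\alpha\text{ for all roots }\alpha\Bigr\},\qquad \Gamma_Q=\pi_1\bigl(\mathbf B_Q,(A_1,\dots,A_p)\bigr).$$ The fission tree $\mathcal T_Q$ has as level $J_l$, $1\le l\le p+1$, the set of classes of the equivalence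 relation on $\{1,\dots,n+1\}$ for which $i\ne j$ are equivalent if and only if $d_{\alpha_{ij}}<l$; the parent of a class in $J_l$ is the class in $J_{l+1}$ containing it, and the child-nodes of a node are ordered by their minima. **Theorem.** 1. For all $n\ge0$ and $k_1,\dots,k_n\ge 0$, the map $\gamma$ is a homomorphism from the direct product group $PB_n\times\prod_i PB_{k_i}$ to $PB_m$; it is injective if $k_i\ge 1$ for all $i$. 2. For every irregular type $Q$ as above, $PB(\mathcal T_Q)$ is a subgroup of $PB_{|J_1|}$, and there is a group isomorphism $\Gamma_Q\simeq PB(\mathcal T_Q)$. -/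

import Mathlib

open scoped BigOperators

noncomputable section

namespace CabledBraids

/-! ### Pure braid groups -/

/-- The space of ordered configurations of `n` distinct points of the complex plane. -/
abbrev Conf (n : ℕ) : Type := {z : Fin n → ℂ // ∀ i j, i ≠ j → z i ≠ z j}

/-- The standard configuration `(0, 1, …, n - 1)`. -/
def stdConf (n : ℕ) : Conf n :=
  ⟨fun i => ((i : ℕ) : ℂ), fun _ _ hij h => hij (Fin.ext (Nat.cast_injective (R := ℂ) h))⟩

/-- The pure braid group on `n` strands. -/
abbrev PB (n : ℕ) : Type := FundamentalGroup (Conf n) (stdConf n)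

/-! ### Block braids, direct sums, and the operadic composition -/

section Substitution

variable {n : ℕ} {k : Fin n → ℕ}

/-- A dilation factor, depending continuously on `(x, y)`, such that after dilating `x` by it,
translates of the configurations `y i` to the points of `x` cannot collide with each other. -/
def dilation (x : Conf n) (y : ∀ i, Conf (k i)) : ℝ :=
  (1 + ∑ i, ∑ j, ‖(y i).1 j‖) * ∑ i, ∑ i', ‖x.1 i - x.1 i'‖⁻¹

/-- The points of the configuration obtained from `x` by replacing its `i`-th point by the
configuration `y i`, for all `i`; the labels are ordered block by block. -/
def substPoint (x : Conf n) (y : ∀ i, Conf (k i)) (p : (i : Fin n) × Fin (k i)) : ℂ :=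
  (dilation x y : ℂ) * x.1 p.1 + (y p.1).1 p.2

theorem norm_sub_lt_dilation (x : Conf n) (y : ∀ i, Conf (k i)) (p q : (i : Fin n) × Fin (k i))
    (h : p.1 ≠ q.1) :
    ‖(y p.1).1 p.2 - (y q.1).1 q.2‖ < dilation x y * ‖x.1 p.1 - x.1 q.1‖ := by
  set S : ℝ := ∑ i, ∑ j, ‖(y i).1 j‖ with hS
  have hblock : ∀ r : (i : Fin n) × Fin (k i), ‖(y r.1).1 r.2‖ ≤ ∑ j, ‖(y r.1).1 j‖ := fun r =>
    Finset.single_le_sum (f := fun j => ‖(y r.1).1 j‖) (fun j _ => norm_nonneg _)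
      (Finset.mem_univ r.2)
  have h1 : ‖(y p.1).1 p.2‖ + ‖(y q.1).1 q.2‖ ≤ S := by
    have h2 : ∑ i ∈ ({p.1, q.1} : Finset (Fin n)), ∑ j, ‖(y i).1 j‖ ≤ S :=
      Finset.sum_le_sum_of_subset_of_nonneg (Finset.subset_univ _)
        (fun i _ _ => Finset.sum_nonneg fun j _ => norm_nonneg _)
    rw [Finset.sum_pair h] at h2
    linarith [hblock p, hblock q]
  have h3 : ‖(y p.1).1 p.2 - (y q.1).1 q.2‖ ≤ S := (norm_sub_le _ _).trans h1
  have hpos : 0 < ‖x.1 p.1 - x.1 q.1‖ := norm_pos_iff.mpr (sub_ne_zero.mpr (x.2 _ _ h))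
  have hinner : ‖x.1 p.1 - x.1 q.1‖⁻¹ ≤ ∑ i', ‖x.1 p.1 - x.1 i'‖⁻¹ :=
    Finset.single_le_sum (f := fun i' => ‖x.1 p.1 - x.1 i'‖⁻¹)
      (fun j _ => inv_nonneg.mpr (norm_nonneg _)) (Finset.mem_univ q.1)
  have houter : ∑ i', ‖x.1 p.1 - x.1 i'‖⁻¹ ≤ ∑ i, ∑ i', ‖x.1 i - x.1 i'‖⁻¹ :=
    Finset.single_le_sum (f := fun i => ∑ i', ‖x.1 i - x.1 i'‖⁻¹)
      (fun i _ => Finset.sum_nonneg fun j _ => inv_nonneg.mpr (norm_nonneg _))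
      (Finset.mem_univ p.1)
  have hS0 : 0 ≤ S := Finset.sum_nonneg fun i _ => Finset.sum_nonneg fun j _ => norm_nonneg _
  have h4 : (1 + S) * ‖x.1 p.1 - x.1 q.1‖⁻¹ ≤ dilation x y :=
    mul_le_mul_of_nonneg_left (hinner.trans houter) (by linarith)
  have h5 := mul_le_mul_of_nonneg_right h4 hpos.le
  rw [mul_assoc, inv_mul_cancel₀ hpos.ne', mul_one] at h5
  linarith

theorem substPoint_ne (x : Conf n) (y : ∀ i, Conf (k i)) (p q : (i : Fin n) × Fin (k i))
    (h : p ≠ q) : substPoint x y p ≠ substPoint x y q := by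
  intro heq
  by_cases h1 : p.1 = q.1
  · obtain ⟨i, j⟩ := p
    obtain ⟨i', j'⟩ := q
    obtain rfl : i = i' := h1
    have : j ≠ j' := fun hj => h (by rw [hj])
    exact (y i).2 j j' this (add_left_cancel heq)
  · have h2 := norm_sub_lt_dilation x y p q h1
    have h3 : (y p.1).1 p.2 - (y q.1).1 q.2 = -((dilation x y : ℂ) * (x.1 p.1 - x.1 q.1)) := by
      unfold substPoint at heq
      linear_combination heq
    rw [h3, norm_neg, norm_mul, Complex.norm_real, Real.norm_eq_abs] at h2
    have h4 := mul_le_mul_of_nonneg_right (le_abs_self (dilation x y))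
      (norm_nonneg (x.1 p.1 - x.1 q.1))
    linarith

theorem continuous_outer (i : Fin n) :
    Continuous fun xy : Conf n × (∀ i, Conf (k i)) => xy.1.1 i :=
  (continuous_apply i).comp (continuous_subtype_val.comp continuous_fst)

theorem continuous_inner (i : Fin n) (j : Fin (k i)) :
    Continuous fun xy : Conf n × (∀ i, Conf (k i)) => (xy.2 i).1 j :=
  (continuous_apply j).comp
    (continuous_subtype_val.comp ((continuous_apply i).comp continuous_snd))

theorem continuous_dilation :
    Continuous fun xy : Conf n × (∀ i, Conf (k i)) => dilation xy.1 xy.2 := by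
  unfold dilation
  refine Continuous.mul ?_ ?_
  · exact continuous_const.add (continuous_finsetSum _ fun i _ =>
      continuous_finsetSum _ fun j _ => (continuous_inner i j).norm)
  · refine continuous_finsetSum _ fun i _ => continuous_finsetSum _ fun i' _ => ?_
    by_cases h : i = i'
    · subst h
      simpa using continuous_const
    · refine Continuous.inv₀ ((continuous_outer i).sub (continuous_outer i')).norm fun xy => ?_
      exact norm_ne_zero_iff.mpr (sub_ne_zero.mpr (xy.1.2 i i' h))

/-- Replacing the `i`-th point of a configuration `x` by a configuration `y i`, for all `i`. -/
def substConf : C(Conf n × (∀ i, Conf (k i)), Conf (∑ i, k i)) where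
  toFun xy := ⟨fun a => substPoint xy.1 xy.2 (finSigmaFinEquiv.symm a), fun a b hab =>
    substPoint_ne _ _ _ _ (finSigmaFinEquiv.symm.injective.ne hab)⟩
  continuous_toFun := by
    refine Continuous.subtype_mk (continuous_pi fun a => ?_) _
    exact ((Complex.continuous_ofReal.comp continuous_dilation).mul (continuous_outer _)).add
      (continuous_inner _ _)

variable (k) in
/-- Replacing the `i`-th point of a configuration by `k i` points next to each other. -/
def blockConf : C(Conf n, Conf (∑ i, k i)) :=
  substConf.comp ⟨fun x => (x, fun i => stdConf (k i)), by fun_prop⟩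

/-- Juxtaposing configurations, from left to right. -/
def sumConf : C(∀ i, Conf (k i), Conf (∑ i, k i)) :=
  substConf.comp ⟨fun y => (stdConf n, y), by fun_prop⟩

variable (k) in
/-- Both `blockConf` and `sumConf` map the standard configurations to the following one; it
consists of real points listed in increasing order, but they need not be `0, 1, 2, …`. -/
def substStd : Conf (∑ i, k i) := substConf (stdConf n, fun i => stdConf (k i))

theorem finSigmaFinEquiv_lt (p q : (i : Fin n) × Fin (k i)) (h : p.1 < q.1) :
    (finSigmaFinEquiv p : ℕ) < (finSigmaFinEquiv q : ℕ) := by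
  set K : ℕ → ℕ := fun s => if hs : s < n then k ⟨s, hs⟩ else 0 with hK
  have key : ∀ r : (i : Fin n) × Fin (k i),
      (finSigmaFinEquiv r : ℕ) = ∑ s ∈ Finset.range r.1, K s + r.2 := by
    intro r
    rw [finSigmaFinEquiv_apply, Finset.sum_range]
    congr 1
    refine Finset.sum_congr rfl fun s _ => ?_
    have hs : (s : ℕ) < n := s.2.trans r.1.2
    simp only [hK, hs, dif_pos]
    rfl
  rw [key, key]
  have h1 : ∑ s ∈ Finset.range (p.1 + 1), K s ≤ ∑ s ∈ Finset.range q.1, K s :=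
    Finset.sum_le_sum_of_subset (Finset.range_mono h)
  rw [Finset.sum_range_succ] at h1
  have h2 : K p.1 = k p.1 := by simp [hK]
  have h3 := p.2.2
  omega

theorem straightLine_ne (t : unitInterval) (a b : Fin (∑ i, k i)) (hab : a ≠ b) :
    (1 - (t : ℝ) : ℂ) * (substStd k).1 a + (t : ℝ) * (stdConf (∑ i, k i)).1 a ≠
      (1 - (t : ℝ) : ℂ) * (substStd k).1 b + (t : ℝ) * (stdConf (∑ i, k i)).1 b := by
  set R := dilation (stdConf n) (fun i => stdConf (k i)) with hR
  have re : ∀ p : (i : Fin n) × Fin (k i),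
      ((1 - (t : ℝ) : ℂ) * (substStd k).1 (finSigmaFinEquiv p) +
        (t : ℝ) * (stdConf (∑ i, k i)).1 (finSigmaFinEquiv p)) =
      (((1 - t) * (R * (p.1 : ℕ) + (p.2 : ℕ)) + t * (finSigmaFinEquiv p : ℕ) : ℝ) : ℂ) := by
    intro p
    have h : (substStd k).1 (finSigmaFinEquiv p) = R * (p.1 : ℕ) + (p.2 : ℕ) := by
      change substPoint _ _ (finSigmaFinEquiv.symm (finSigmaFinEquiv p)) = _
      rw [Equiv.symm_apply_apply]
      rfl
    rw [h]
    simp [stdConf]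
  have key : ∀ u v w z : ℝ, u < v → w < z → (1 - t) * u + t * w < (1 - t) * v + t * z := by
    intro u v w z h1 h2
    have h3 : 0 ≤ (t : ℝ) := t.2.1
    have h4 : (t : ℝ) ≤ 1 := t.2.2
    rcases h3.eq_or_lt with h | h
    · rw [← h]; linarith
    · have := mul_le_mul_of_nonneg_left h1.le (sub_nonneg.mpr h4)
      have := mul_lt_mul_of_pos_left h2 h
      linarith
  have lt1 : ∀ p q : (i : Fin n) × Fin (k i), p.1 < q.1 →
      (1 - t) * (R * (p.1 : ℕ) + (p.2 : ℕ)) + t * (finSigmaFinEquiv p : ℕ) <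
        (1 - t) * (R * (q.1 : ℕ) + (q.2 : ℕ)) + t * ((finSigmaFinEquiv q : ℕ) : ℝ) := by
    intro p q h
    refine key _ _ _ _ ?_ (by exact_mod_cast finSigmaFinEquiv_lt p q h)
    have h1 := norm_sub_lt_dilation (stdConf n) (fun i => stdConf (k i)) p q h.ne
    have h2 : ‖(stdConf n).1 p.1 - (stdConf n).1 q.1‖ = ((q.1 : ℕ) : ℝ) - (p.1 : ℕ) := by
      have : (stdConf n).1 p.1 - (stdConf n).1 q.1 =
          (((p.1 : ℕ) - (q.1 : ℕ) : ℝ) : ℂ) := by simp [stdConf]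
      rw [this, Complex.norm_real, Real.norm_eq_abs, abs_sub_comm, abs_of_nonneg]
      have : ((p.1 : ℕ) : ℝ) < (q.1 : ℕ) := by exact_mod_cast h
      linarith
    have h3 : ((p.2 : ℕ) : ℝ) - (q.2 : ℕ) ≤
        ‖(stdConf (k p.1)).1 p.2 - (stdConf (k q.1)).1 q.2‖ := by
      have : (stdConf (k p.1)).1 p.2 - (stdConf (k q.1)).1 q.2 =
          (((p.2 : ℕ) - (q.2 : ℕ) : ℝ) : ℂ) := by simp [stdConf]
      rw [this, Complex.norm_real]
      exact le_abs_self _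
    rw [h2] at h1
    have h4 := lt_of_le_of_lt h3 h1
    rw [← hR] at h4
    linarith
  have lt2 : ∀ (i : Fin n) (j j' : Fin (k i)), j < j' →
      (1 - t) * (R * (i : ℕ) + (j : ℕ)) + t * ((finSigmaFinEquiv ⟨i, j⟩ : ℕ) : ℝ) <
        (1 - t) * (R * (i : ℕ) + (j' : ℕ)) + t * ((finSigmaFinEquiv ⟨i, j'⟩ : ℕ) : ℝ) := by
    intro i j j' h
    have h1 : ((j : ℕ) : ℝ) < (j' : ℕ) := by exact_mod_cast h
    refine key _ _ _ _ (by linarith) ?_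
    rw [finSigmaFinEquiv_apply, finSigmaFinEquiv_apply]
    exact_mod_cast Nat.add_lt_add_left h _
  obtain ⟨p, rfl⟩ := finSigmaFinEquiv.surjective a
  obtain ⟨q, rfl⟩ := finSigmaFinEquiv.surjective b
  have hpq : p ≠ q := fun h => hab (by rw [h])
  rw [re, re]
  intro h
  have h := Complex.ofReal_injective h
  rcases lt_trichotomy p.1 q.1 with h1 | h1 | h1
  · exact absurd h (lt1 p q h1).ne
  · obtain ⟨i, j⟩ := p
    obtain ⟨i', j'⟩ := q
    obtain rfl : i = i' := h1
    rcases lt_trichotomy j j' with h2 | h2 | h2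
    · exact absurd h (lt2 i j j' h2).ne
    · exact hpq (by rw [h2])
    · exact absurd h (lt2 i j' j h2).ne'
  · exact absurd h (lt1 q p h1).ne'

variable (k) in
/-- The straight-line path from the configuration `substStd k` to the standard one; all the
configurations on it consist of real points listed in increasing order. -/
def straightLine : Path (substStd k) (stdConf (∑ i, k i)) where
  toFun t := ⟨fun a => (1 - (t : ℝ) : ℂ) * (substStd k).1 a +
    (t : ℝ) * (stdConf (∑ i, k i)).1 a, straightLine_ne t⟩
  continuous_toFun := by
    refine Continuous.subtype_mk (continuous_pi fun a => ?_) _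
    fun_prop
  source' := by ext a; simp
  target' := by ext a; simp

variable (k) in
/-- The change of base point along `straightLine`. -/
def rebase : FundamentalGroup (Conf (∑ i, k i)) (substStd k) ≃* PB (∑ i, k i) :=
  FundamentalGroup.fundamentalGroupMulEquivOfPath (straightLine k)

variable (k) in
/-- The block braid `σ⟨k₁, …, kₙ⟩`: the `i`-th strand of `σ` is replaced by `k i` parallel
copies of it. -/
def blockBraid (σ : PB n) : PB (∑ i, k i) :=
  rebase k (FundamentalGroup.map (blockConf k) (stdConf n) σ)

/-- The direct sum `τ₁ ⊕ ⋯ ⊕ τₙ` of pure braids. -/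
def directSum (τ : ∀ i, PB (k i)) : PB (∑ i, k i) :=
  rebase k (FundamentalGroup.map sumConf (fun i => stdConf (k i))
    (Path.Homotopic.pi fun i => FundamentalGroup.toPath (τ i)))

/-- The operadic composition `γ(σ; τ₁, …, τₙ) = σ⟨k₁, …, kₙ⟩ · (τ₁ ⊕ ⋯ ⊕ τₙ)`. -/
def γ (στ : PB n × (∀ i, PB (k i))) : PB (∑ i, k i) :=
  blockBraid k στ.1 * directSum στ.2

end Substitution

/-! ### Trees and pure cabled braid groups -/

/-- `LevelTree m` is the type of finite rooted trees with ordered sets of child-nodes, with a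
distinguished lowest level consisting of `m` nodes (the leaves), listed from left to right.
A tree is built level by level from its root: `grow T k` has a new lowest level, where the
`i`-th node of the lowest level of `T` has `k i` child-nodes. -/
inductive LevelTree : ℕ → Type
  | root : LevelTree 1
  | grow {m : ℕ} (T : LevelTree m) (k : Fin m → ℕ) : LevelTree (∑ i, k i)

/-- The pure cabled braid group of a tree with `m` leaves, as a subset of `PB m`. -/
def cabledBraids : {m : ℕ} → LevelTree m → Set (PB m)
  | _, .root => Set.univ
  | _, .grow T k => γ (k := k) '' (cabledBraids T ×ˢ Set.univ)

/-! ### Irregular types of type A and their deformations -/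

/-- The standard Cartan subalgebra of `𝔰𝔩ₙ₊₁(ℂ)`: traceless diagonal matrices, written as
vectors of `ℂⁿ⁺¹`. -/
def Cartan (n : ℕ) : Submodule ℂ (Fin (n + 1) → ℂ) where
  carrier := {v | ∑ i, v i = 0}
  add_mem' := by
    intro v w hv hw
    change ∑ i, (v i + w i) = 0
    rw [Finset.sum_add_distrib, show ∑ i, v i = 0 from hv, show ∑ i, w i = 0 from hw, add_zero]
  zero_mem' := by simp
  smul_mem' := by
    intro c v hv
    change ∑ i, c * v i = 0
    rw [← Finset.mul_sum, show ∑ i, v i = 0 from hv, mul_zero]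

/-- The linear functional `αᵢ - αⱼ`; these are the roots of `𝔰𝔩ₙ₊₁(ℂ)`, for `i ≠ j`. -/
def root {n : ℕ} (i j : Fin (n + 1)) : Cartan n →ₗ[ℂ] ℂ :=
  ((LinearMap.proj i : (Fin (n + 1) → ℂ) →ₗ[ℂ] ℂ) - LinearMap.proj j).comp (Cartan n).subtype

/-- An irregular type `Q = A₁ x + ⋯ + A_p x^p`, where `x = z⁻¹` and the coefficients are in the
Cartan subalgebra; the coefficient of `x ^ (l + 1)` is `Q l`. -/
abbrev IrregularType (n p : ℕ) : Type := Fin p → Cartan n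

variable {n p : ℕ}

/-- The polynomial `(αᵢ - αⱼ)(Q)`, with zero constant term. -/
def rootPoly (Q : IrregularType n p) (i j : Fin (n + 1)) : Polynomial ℂ :=
  ∑ l : Fin p, Polynomial.monomial ((l : ℕ) + 1) (root i j (Q l))

/-- The degree `d_α` of `α(Q)` for the root `α = αᵢ - αⱼ` (equal to `0` if `α(Q) = 0`). -/
def rootDegree (Q : IrregularType n p) (i j : Fin (n + 1)) : ℕ := (rootPoly Q i j).natDegree

/-- The universal deformation space of `Q`, as a subspace of `𝔱 ^ p`. -/
def deformationSpace (Q : IrregularType n p) : Set (IrregularType n p) :=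
  {Q' | ∀ i j, i ≠ j → rootDegree Q' i j = rootDegree Q i j}

/-- The pure local wild mapping class group `Γ_Q`. -/
abbrev WMCG (Q : IrregularType n p) : Type :=
  FundamentalGroup (deformationSpace Q) ⟨Q, fun _ _ _ => rfl⟩

/-! ### Fission trees -/

/-- `i` and `j` are in the same part at level `l`: either `i = j`, or `αᵢ - αⱼ` is in the
subsystem `Φ_l` of the roots `α` such that `d_α < l`. -/
def SamePart (Q : IrregularType n p) (l : ℕ) (i j : Fin (n + 1)) : Prop :=
  i = j ∨ (i ≠ j ∧ rootDegree Q i j < l)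

open Classical in
/-- The set `J_l` of parts at level `l`, each part being represented by its minimum. -/
def fissionLevel (Q : IrregularType n p) (l : ℕ) : Finset (Fin (n + 1)) :=
  Finset.univ.filter fun c => ∀ b, SamePart Q l c b → c ≤ b

open Classical in
/-- The parent in `J_{l + 1}` of a node `c` in `J_l`: the part at level `l + 1` containing `c`. -/
def fissionParent (Q : IrregularType n p) (l : ℕ) (c : Fin (n + 1)) : Fin (n + 1) :=
  (Finset.univ.filter fun b => SamePart Q (l + 1) c b).min'
    ⟨c, Finset.mem_filter.mpr ⟨Finset.mem_univ c, Or.inl rfl⟩⟩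

/-- The child-nodes in `J_l` of a node `c` in `J_{l + 1}`. -/
def fissionChildren (Q : IrregularType n p) (l : ℕ) (c : Fin (n + 1)) : Finset (Fin (n + 1)) :=
  (fissionLevel Q l).filter fun b => fissionParent Q l b = c

/-- The part of the fission tree of `Q` consisting of the levels `p + 1, p, …, p + 1 - d`, where
`p + 1` is the level of the root, together with the list (from left to right) of the nodes in
`J_{p + 1 - d}`. -/
def fissionStage (Q : IrregularType n p) : ℕ → (m : ℕ) × LevelTree m × (Fin m → Fin (n + 1))
  | 0 => ⟨1, LevelTree.root, fun _ => 0⟩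
  | d + 1 =>
    let s := fissionStage Q d
    let children : Fin s.1 → Finset (Fin (n + 1)) := fun i =>
      fissionChildren Q (p - d) (s.2.2 i)
    ⟨∑ i, (children i).card, s.2.1.grow fun i => (children i).card, fun a =>
      (children (finSigmaFinEquiv.symm a).1).orderEmbOfFin rfl (finSigmaFinEquiv.symm a).2⟩

/-- The number `|J₁|` of leaves of the fission tree. -/
def leafCount (Q : IrregularType n p) : ℕ := (fissionStage Q p).1

/-- The fission tree `T_Q`, with levels `p + 1, p, …, 1`. -/
def fissionTree (Q : IrregularType n p) : LevelTree (leafCount Q) := (fissionStage Q p).2.1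

end CabledBraids

end

open CabledBraids

namespace CabledBraids

/-! ### Fundamental groups: homotopy equivalences and products. -/

section FundamentalGroupLemmas

open CategoryTheory

variable {X Y : Type} [TopologicalSpace X] [TopologicalSpace Y]

/-! Up to a change of base point, `γ` is what the single continuous map `substConf` induces on
fundamental groups, once the fundamental group of a product is identified with the product of the
groups (`γ_eq`); hence it is a homomorphism. If no block is empty, `substConf` has a left inverse up
to homotopy (`splitHomotopy`): keep the first point of each block as outer configuration, and each
block as inner configuration. So `γ` is injective.

For the second part, the degree conditions decouple over the coefficients, so the deformation space
is a product of spaces `levelSpace Q l`. In level `l`, coordinates in the same class of `J_l` agree,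
those in distinct classes with the same parent differ, and the others are unrelated. Up to a
translation, which the trace condition fixes, this is a product of configuration spaces, one for
each node of `J_{l+1}`, with one point for each child (`levelSpaceEquiv`). Thus `Γ_Q` is the product
of the pure braid groups of all nodes above the leaves. The cabled braid group is the same product:
every such node has a child, so injectivity of `γ` splits off one level at a time
(`IsCabledBraidGroup.grow`). -/

/-- A map with a left inverse up to homotopy is injective on fundamental groups. -/
theorem map_injective_of_homotopic_leftInverse (f : C(X, Y)) (g : C(Y, X))
    (h : (g.comp f).Homotopic (ContinuousMap.id X)) (x : X) :
    Function.Injective (FundamentalGroup.map f x) := by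
  obtain ⟨H⟩ := h
  -- The homotopy makes the composite functor isomorphic to the identity, hence faithful; then its
  -- first factor is faithful too.
  have : (FundamentalGroupoid.map f ⋙ FundamentalGroupoid.map g).Faithful :=
    Functor.Faithful.of_iso
      (F := 𝟭 (FundamentalGroupoid X))
      (((asIso (FundamentalGroupoidFunctor.homotopicMapsNatIso H)).trans
        (eqToIso FundamentalGroupoid.map_id)).symm.trans
        (eqToIso (FundamentalGroupoid.map_comp g f)))
  have : (FundamentalGroupoid.map f).Faithful := Functor.Faithful.of_comp _
    (FundamentalGroupoid.map g)
  intro p q hpq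
  exact (FundamentalGroupoid.map f).map_injective hpq

/-- A homotopy equivalence induces isomorphisms of fundamental groups. -/
noncomputable def fundamentalGroupEquivOfHomotopyEquiv (e : ContinuousMap.HomotopyEquiv X Y)
    (x : X) : FundamentalGroup X x ≃* FundamentalGroup Y (e x) :=
  (FundamentalGroupoidFunctor.equivOfHomotopyEquiv e).fullyFaithfulFunctor.mulEquivEnd
    (FundamentalGroupoid.mk x)

/-- The fundamental group of a product is the product of the fundamental groups. -/
noncomputable def fundamentalGroupProd (x : X) (y : Y) :
    FundamentalGroup X x × FundamentalGroup Y y ≃* FundamentalGroup (X × Y) (x, y) where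
  toFun p := Path.Homotopic.prod p.1 p.2
  invFun p := (Path.Homotopic.projLeft p, Path.Homotopic.projRight p)
  left_inv _ := Prod.ext (Path.Homotopic.projLeft_prod _ _) (Path.Homotopic.projRight_prod _ _)
  right_inv p := Path.Homotopic.prod_projLeft_projRight p
  map_mul' _ _ := (Path.Homotopic.comp_prod_eq_prod_comp _ _ _ _).symm

/-- The fundamental group of a product of a family of spaces is the product of the fundamental
groups. -/
noncomputable def fundamentalGroupPi {ι : Type} {Z : ι → Type} [∀ i, TopologicalSpace (Z i)]
    (z : ∀ i, Z i) : (∀ i, FundamentalGroup (Z i) (z i)) ≃* FundamentalGroup (∀ i, Z i) z where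
  toFun p := Path.Homotopic.pi p
  invFun p i := Path.Homotopic.proj i p
  left_inv p := funext fun i => Path.Homotopic.proj_pi i p
  right_inv p := Path.Homotopic.pi_proj p
  map_mul' _ _ := (Path.Homotopic.comp_pi_eq_pi_comp _ _).symm

theorem map_prodMk_const (x : X) (y : Y) (p : FundamentalGroup X x) :
    FundamentalGroup.map (⟨fun x => (x, y), by fun_prop⟩ : C(X, X × Y)) x p =
      fundamentalGroupProd x y (p, 1) := by
  induction p using Path.Homotopic.Quotient.ind with
  | mk p => rfl

theorem map_const_prodMk (x : X) (y : Y) (p : FundamentalGroup Y y) :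
    FundamentalGroup.map (⟨fun y => (x, y), by fun_prop⟩ : C(Y, X × Y)) y p =
      fundamentalGroupProd x y (1, p) := by
  induction p using Path.Homotopic.Quotient.ind with
  | mk p => rfl

end FundamentalGroupLemmas

/-! ### The operadic composition: multiplicativity and injectivity. -/

section Composition

variable {n : ℕ} {k : Fin n → ℕ}

variable (k) in
/-- The homomorphism of fundamental groups induced by `substConf`. -/
noncomputable def substHom : FundamentalGroup (Conf n × (∀ i, Conf (k i))) (stdConf n, fun i => stdConf (k i)) →*
    FundamentalGroup (Conf (∑ i, k i)) (substStd k) :=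
  FundamentalGroup.map substConf _

variable (k) in
/-- The fundamental group of the source of `substConf`, as a product of pure braid groups. -/
noncomputable def braidProd : PB n × (∀ i, PB (k i)) ≃*
    FundamentalGroup (Conf n × (∀ i, Conf (k i))) (stdConf n, fun i => stdConf (k i)) :=
  (MulEquiv.prodCongr (MulEquiv.refl _) (fundamentalGroupPi _)).trans (fundamentalGroupProd _ _)

theorem blockBraid_eq (σ : PB n) :
    blockBraid k σ = rebase k (substHom k (braidProd k (σ, 1))) := by
  change _ = rebase k (substHom k (fundamentalGroupProd _ _ (σ, fundamentalGroupPi _ 1)))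
  rw [map_one, ← map_prodMk_const]
  induction σ using Path.Homotopic.Quotient.ind with
  | mk p => rfl

theorem directSum_eq (τ : ∀ i, PB (k i)) :
    directSum τ = rebase k (substHom k (braidProd k (1, τ))) := by
  change _ = rebase k (substHom k (fundamentalGroupProd _ _ (1, fundamentalGroupPi _ τ)))
  rw [← map_const_prodMk]
  change rebase k (FundamentalGroup.map sumConf _
    (fundamentalGroupPi (fun i => stdConf (k i)) τ)) = _
  generalize fundamentalGroupPi (fun i => stdConf (k i)) τ = p
  induction p using Path.Homotopic.Quotient.ind with
  | mk p => rfl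

/-- Block braids and direct sums are the values of one homomorphism at `(σ, 1)` and `(1, τ)`,
because `blockConf` and `sumConf` restrict `substConf` to slices of the product. -/
theorem γ_eq (a : PB n × (∀ i, PB (k i))) :
    γ a = rebase k (substHom k (braidProd k a)) := by
  rw [γ, blockBraid_eq, directSum_eq, ← map_mul, ← map_mul, ← map_mul]
  simp

theorem γ_mul (a b : PB n × (∀ i, PB (k i))) : γ (a * b) = γ a * γ b := by
  rw [γ_eq, γ_eq, γ_eq, map_mul, map_mul, map_mul]

/-- The operadic composition as a group homomorphism. -/
noncomputable def γHom (k : Fin n → ℕ) : PB n × (∀ i, PB (k i)) →* PB (∑ i, k i) :=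
  MonoidHom.mk' γ γ_mul

theorem substConf_finSigmaFinEquiv (w : Conf n × (∀ i, Conf (k i)))
    (p : (i : Fin n) × Fin (k i)) :
    (substConf w).1 (finSigmaFinEquiv p) = substPoint w.1 w.2 p :=
  congrArg (substPoint w.1 w.2) (Equiv.symm_apply_apply _ _)

/-- A convex combination of `norm_sub_lt_dilation` and the positivity of the distance between outer
points; it keeps first points of blocks apart during `splitHomotopy`. -/
theorem norm_sub_lt_dilation_fst (x : Conf n) (y : ∀ i, Conf (k i)) (t : ℝ) (h0 : 0 ≤ t)
    (h1 : t ≤ 1) (p q : (i : Fin n) × Fin (k i)) (h : p.1 ≠ q.1) :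
    t * ‖(y p.1).1 p.2 - (y q.1).1 q.2‖ <
      (t * dilation x y + (1 - t)) * ‖x.1 p.1 - x.1 q.1‖ := by
  have hd := norm_sub_lt_dilation x y p q h
  have hpos : 0 < ‖x.1 p.1 - x.1 q.1‖ := norm_pos_iff.mpr (sub_ne_zero.mpr (x.2 _ _ h))
  rcases h0.eq_or_lt with rfl | h0
  · simpa using hpos
  · have := mul_lt_mul_of_pos_left hd h0
    have := mul_nonneg (sub_nonneg.mpr h1) hpos.le
    linarith

/-- A configuration `substConf (x, y)` determines the configuration of the first points of all
blocks, and the configuration of the points of each block. -/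
def splitConf (hk : ∀ i, 1 ≤ k i) : C(Conf (∑ i, k i), Conf n × (∀ i, Conf (k i))) where
  toFun z := (⟨fun i => z.1 (finSigmaFinEquiv ⟨i, ⟨0, hk i⟩⟩), fun i j hij => z.2 _ _ fun h =>
      hij (congrArg Sigma.fst (finSigmaFinEquiv.injective h))⟩,
    fun i => ⟨fun a => z.1 (finSigmaFinEquiv ⟨i, a⟩), fun a b hab => z.2 _ _ fun h =>
      hab (by simpa using finSigmaFinEquiv.injective h)⟩)
  continuous_toFun := by
    refine Continuous.prodMk (Continuous.subtype_mk (continuous_pi fun i => ?_) _)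
      (continuous_pi fun i => Continuous.subtype_mk (continuous_pi fun a => ?_) _)
    · exact (continuous_apply _).comp continuous_subtype_val
    · exact (continuous_apply _).comp continuous_subtype_val

theorem splitHomotopy_fst_ne (x : Conf n) (y : ∀ i, Conf (k i)) (hk : ∀ i, 1 ≤ k i)
    (t : unitInterval) (i j : Fin n) (hij : i ≠ j) :
    (((1 - t) * dilation x y + t : ℝ) : ℂ) * x.1 i + ((1 - t : ℝ) : ℂ) * (y i).1 ⟨0, hk i⟩ ≠
      (((1 - t) * dilation x y + t : ℝ) : ℂ) * x.1 j + ((1 - t : ℝ) : ℂ) * (y j).1 ⟨0, hk j⟩ := by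
  intro h
  -- The homotopy runs from the composite to the identity, so its time `t` is the parameter `1 - t`
  -- of the estimate.
  have h1 := norm_sub_lt_dilation_fst x y (1 - t) (sub_nonneg.mpr t.2.2)
    (by linarith [t.2.1]) ⟨i, ⟨0, hk i⟩⟩ ⟨j, ⟨0, hk j⟩⟩ hij
  have h2 : ((1 - t : ℝ) : ℂ) * ((y i).1 ⟨0, hk i⟩ - (y j).1 ⟨0, hk j⟩) =
      -((((1 - t) * dilation x y + t : ℝ) : ℂ) * (x.1 i - x.1 j)) := by
    linear_combination h
  have h3 := congrArg norm h2
  rw [norm_neg, norm_mul, norm_mul, Complex.norm_real, Complex.norm_real, Real.norm_eq_abs,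
    Real.norm_eq_abs, abs_of_nonneg (sub_nonneg.mpr t.2.2)] at h3
  have h4 := mul_le_mul_of_nonneg_right (le_abs_self ((1 - t) * dilation x y + t))
    (norm_nonneg (x.1 i - x.1 j))
  dsimp only at h1
  rw [sub_sub_cancel] at h1
  linarith

/-- The homotopy contracting the translations and dilations in `splitConf.comp substConf`. -/
noncomputable def splitHomotopy (hk : ∀ i, 1 ≤ k i) :
    ((splitConf hk).comp substConf).Homotopy (ContinuousMap.id _) where
  toFun w := (⟨fun i => (((1 - w.1) * dilation w.2.1 w.2.2 + w.1 : ℝ) : ℂ) * w.2.1.1 i +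
      ((1 - w.1 : ℝ) : ℂ) * (w.2.2 i).1 ⟨0, hk i⟩,
      splitHomotopy_fst_ne w.2.1 w.2.2 hk w.1⟩,
    -- Each block is only translated, so its points stay distinct.
    fun i => ⟨fun a => ((1 - w.1 : ℝ) : ℂ) * ((dilation w.2.1 w.2.2 : ℂ) * w.2.1.1 i) +
      (w.2.2 i).1 a, fun a b hab h => (w.2.2 i).2 a b hab (add_left_cancel h)⟩)
  continuous_toFun := by
    have hd : Continuous fun w : unitInterval × (Conf n × (∀ i, Conf (k i))) =>
      dilation w.2.1 w.2.2 := continuous_dilation.comp continuous_snd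
    have ho : ∀ i, Continuous fun w : unitInterval × (Conf n × (∀ i, Conf (k i))) =>
      w.2.1.1 i := fun i => (continuous_outer i).comp continuous_snd
    have hi : ∀ i a, Continuous fun w : unitInterval × (Conf n × (∀ i, Conf (k i))) =>
      (w.2.2 i).1 a := fun i a => (continuous_inner i a).comp continuous_snd
    refine Continuous.prodMk (Continuous.subtype_mk (continuous_pi fun i => ?_) _)
      (continuous_pi fun i => Continuous.subtype_mk (continuous_pi fun a => ?_) _)
    · have := ho i
      have := hi i ⟨0, hk i⟩
      fun_prop
    · have := ho i
      have := hi i a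
      fun_prop
  map_zero_left w := by
    refine Prod.ext (Subtype.ext (funext fun i => ?_))
      (funext fun i => Subtype.ext (funext fun a => ?_))
    · simp [splitConf, substConf_finSigmaFinEquiv, substPoint]
    · simp [splitConf, substConf_finSigmaFinEquiv, substPoint]
  map_one_left w := by
    refine Prod.ext (Subtype.ext (funext fun i => ?_))
      (funext fun i => Subtype.ext (funext fun a => ?_))
    · simp
    · simp

theorem γ_injective (hk : ∀ i, 1 ≤ k i) :
    Function.Injective (γ : PB n × (∀ i, PB (k i)) → PB (∑ i, k i)) := by
  intro a b h
  rw [γ_eq, γ_eq] at h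
  exact (braidProd k).injective (map_injective_of_homotopic_leftInverse _ _ ⟨splitHomotopy hk⟩ _
    ((rebase k).injective h))

end Composition

/-! ### Connectedness of configuration spaces. -/

section Configurations

/-- On the complex line through `z` and `w`, each pair of points collides for at most one parameter;
the complement of a countable set in `ℂ` is path connected, so `0` can be joined to `1` avoiding
these parameters. -/
theorem joined_of_mem_Conf {n : ℕ} (z w : Conf n) : Joined z w := by
  set S : Set ℂ := ⋃ i : Fin n, ⋃ j : Fin n,
    {t | i ≠ j ∧ z.1 i + t * (w.1 i - z.1 i) = z.1 j + t * (w.1 j - z.1 j)} with hS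
  have hfin : S.Countable := by
    refine Set.countable_iUnion fun i => Set.countable_iUnion fun j => Set.Subsingleton.countable ?_
    rintro s ⟨hij, hs⟩ t ⟨-, ht⟩
    have h : (s - t) * ((w.1 i - z.1 i) - (w.1 j - z.1 j)) = 0 := by linear_combination hs - ht
    rcases mul_eq_zero.mp h with h | h
    · exact sub_eq_zero.mp h
    · exact absurd (by linear_combination hs - s * h) (z.2 i j hij)
  have hmem : ∀ t, t ∈ Sᶜ → ∀ i j, i ≠ j →
      z.1 i + t * (w.1 i - z.1 i) ≠ z.1 j + t * (w.1 j - z.1 j) := by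
    intro t ht i j hij h
    exact ht (Set.mem_iUnion.mpr ⟨i, Set.mem_iUnion.mpr ⟨j, hij, h⟩⟩)
  have h0 : (0 : ℂ) ∈ Sᶜ := by
    intro h
    obtain ⟨i, h⟩ := Set.mem_iUnion.mp h
    obtain ⟨j, hij, h⟩ := Set.mem_iUnion.mp h
    exact z.2 i j hij (by simpa using h)
  have h1 : (1 : ℂ) ∈ Sᶜ := by
    intro h
    obtain ⟨i, h⟩ := Set.mem_iUnion.mp h
    obtain ⟨j, hij, h⟩ := Set.mem_iUnion.mp h
    exact w.2 i j hij (by simpa using h)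
  have hrank : 1 < Module.rank ℝ ℂ := by simp [Complex.rank_real_complex]
  obtain ⟨p, hp⟩ := (hfin.isPathConnected_compl_of_one_lt_rank hrank).joinedIn 0 h0 1 h1
  exact ⟨{
    toFun := fun t => ⟨fun i => z.1 i + p t * (w.1 i - z.1 i), hmem _ (hp t)⟩
    continuous_toFun := by
      refine Continuous.subtype_mk (continuous_pi fun i => ?_) _
      fun_prop
    source' := by ext i; simp
    target' := by ext i; simp }⟩

instance (n : ℕ) : PathConnectedSpace (Conf n) where
  nonempty := ⟨stdConf n⟩
  joined := joined_of_mem_Conf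

instance : ContractibleSpace (Conf 1) :=
  have e : Conf 1 ≃ₜ (Fin 1 → ℂ) :=
    { toFun := Subtype.val
      invFun := fun z => ⟨z, fun i j h => absurd (Subsingleton.elim i j) h⟩
      left_inv := fun _ => rfl
      right_inv := fun _ => rfl
      continuous_toFun := continuous_subtype_val
      continuous_invFun := Continuous.subtype_mk continuous_id _ }
  e.contractibleSpace

instance : Subsingleton (PB 1) :=
  inferInstanceAs (Subsingleton (Path.Homotopic.Quotient (stdConf 1) (stdConf 1)))

end Configurations

/-! ### Cabled braid groups of trees as iterated products. -/

section Trees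

/-- The pure cabled braid group of `T` is a subgroup of the pure braid group, isomorphic
to `G`. -/
def IsCabledBraidGroup (G : Type) [Group G] {m : ℕ} (T : LevelTree m) : Prop :=
  ∃ H : Subgroup (PB m), (H : Set (PB m)) = cabledBraids T ∧ Nonempty (G ≃* H)

theorem IsCabledBraidGroup.congr {G G' : Type} [Group G] [Group G'] {m : ℕ} {T : LevelTree m}
    (h : IsCabledBraidGroup G T) (e : G' ≃* G) : IsCabledBraidGroup G' T := by
  obtain ⟨H, hH, ⟨f⟩⟩ := h
  exact ⟨H, hH, ⟨e.trans f⟩⟩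

theorem isCabledBraidGroup_root (G : Type) [Group G] [Subsingleton G] :
    IsCabledBraidGroup G LevelTree.root :=
  have : Unique G := uniqueOfSubsingleton 1
  have : Unique (⊤ : Subgroup (PB 1)) := uniqueOfSubsingleton 1
  ⟨⊤, rfl, ⟨MulEquiv.ofUnique⟩⟩

theorem IsCabledBraidGroup.grow {G : Type} [Group G] {m : ℕ} {T : LevelTree m}
    (h : IsCabledBraidGroup G T) (k : Fin m → ℕ) (hk : ∀ i, 1 ≤ k i) :
    IsCabledBraidGroup (G × (∀ i, PB (k i))) (T.grow k) := by
  obtain ⟨H, hH, ⟨f⟩⟩ := h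
  have hinj : Function.Injective (γHom k) := γ_injective hk
  refine ⟨(H.prod ⊤).map (γHom k), ?_, ⟨?_⟩⟩
  · rw [Subgroup.coe_map, Subgroup.coe_prod, hH]
    rfl
  · exact ((MulEquiv.prodCongr f Subgroup.topEquiv.symm).trans
      (Subgroup.prodEquiv H ⊤).symm).trans (Subgroup.equivMapOfInjective _ _ hinj)

end Trees

variable {n p : ℕ}

/-! ### Degrees of roots, coefficient spaces and fission levels. -/

section Levels

theorem rootPoly_coeff_succ (Q : IrregularType n p) (i j : Fin (n + 1)) (l : Fin p) :
    (rootPoly Q i j).coeff (l + 1) = root i j (Q l) := by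
  rw [rootPoly, Polynomial.finsetSum_coeff, Finset.sum_eq_single l]
  · simp
  · intro b _ hb
    rw [Polynomial.coeff_monomial, if_neg]
    intro h
    exact hb (Fin.ext (by omega))
  · simp

theorem rootPoly_coeff_eq_zero (Q : IrregularType n p) (i j : Fin (n + 1)) (m : ℕ) (hm : p < m) :
    (rootPoly Q i j).coeff m = 0 := by
  rw [rootPoly, Polynomial.finsetSum_coeff]
  refine Finset.sum_eq_zero fun b _ => ?_
  rw [Polynomial.coeff_monomial, if_neg]
  have := b.2
  omega

theorem rootDegree_le (Q : IrregularType n p) (i j : Fin (n + 1)) : rootDegree Q i j ≤ p :=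
  Polynomial.natDegree_le_iff_coeff_eq_zero.mpr fun m hm => rootPoly_coeff_eq_zero Q i j m hm

/-- For `d = 0` the nonvanishing condition is void, in accordance with the convention that the zero
polynomial has degree `0`. -/
theorem rootDegree_eq_iff (Q : IrregularType n p) (i j : Fin (n + 1)) (d : ℕ) (hd : d ≤ p) :
    rootDegree Q i j = d ↔ ∀ l : Fin p, (d < l + 1 → root i j (Q l) = 0) ∧
      (d = l + 1 → root i j (Q l) ≠ 0) := by
  constructor
  · rintro rfl l
    rw [← rootPoly_coeff_succ]
    refine ⟨fun h => Polynomial.coeff_eq_zero_of_natDegree_lt h, fun h => ?_⟩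
    rw [← h]
    refine Polynomial.leadingCoeff_ne_zero.mpr fun h0 => ?_
    rw [rootDegree, h0, Polynomial.natDegree_zero] at h
    omega
  · intro h
    refine le_antisymm (Polynomial.natDegree_le_iff_coeff_eq_zero.mpr fun m hm => ?_) ?_
    · rcases le_or_gt m p with hmp | hmp
      · obtain ⟨m, rfl⟩ : ∃ m', m = m' + 1 := ⟨m - 1, by omega⟩
        exact (rootPoly_coeff_succ Q i j ⟨m, hmp⟩).trans ((h ⟨m, hmp⟩).1 hm)
      · exact rootPoly_coeff_eq_zero Q i j m hmp
    · rcases d with _ | d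
      · exact Nat.zero_le _
      · refine Polynomial.le_natDegree_of_ne_zero ?_
        rw [rootPoly_coeff_succ Q i j ⟨d, hd⟩]
        exact (h ⟨d, hd⟩).2 rfl

theorem root_eq_zero_iff (i j : Fin (n + 1)) (v : Cartan n) :
    root i j v = 0 ↔ v.1 i = v.1 j :=
  sub_eq_zero

/-- The space of the coefficients of `x ^ l` of the deformations of `Q`. -/
def levelSpace (Q : IrregularType n p) (l : ℕ) : Set (Cartan n) :=
  {v | ∀ i j, i ≠ j → (rootDegree Q i j < l → v.1 i = v.1 j) ∧
    (rootDegree Q i j = l → v.1 i ≠ v.1 j)}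

theorem mem_deformationSpace_iff (Q Q' : IrregularType n p) :
    Q' ∈ deformationSpace Q ↔ ∀ l : Fin p, Q' l ∈ levelSpace Q (l + 1) := by
  constructor
  · intro h l i j hij
    have := (rootDegree_eq_iff Q' i j _ (rootDegree_le Q i j)).mp (h i j hij) l
    rwa [Ne, root_eq_zero_iff] at this
  · intro h i j hij
    refine (rootDegree_eq_iff Q' i j _ (rootDegree_le Q i j)).mpr fun l => ?_
    rw [Ne, root_eq_zero_iff]
    exact h l i j hij

/-- The deformation space is the product of the spaces of its coefficients. -/
def deformationSpaceHomeomorph (Q : IrregularType n p) :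
    deformationSpace Q ≃ₜ ∀ l : Fin p, levelSpace Q (l + 1) where
  toFun Q' l := ⟨Q'.1 l, (mem_deformationSpace_iff Q _).mp Q'.2 l⟩
  invFun v := ⟨fun l => (v l).1, (mem_deformationSpace_iff Q _).mpr fun l => (v l).2⟩
  left_inv _ := rfl
  right_inv _ := rfl
  continuous_toFun := continuous_pi fun l =>
    ((continuous_apply l).comp continuous_subtype_val).subtype_mk _
  continuous_invFun := Continuous.subtype_mk
    (continuous_pi fun l => continuous_subtype_val.comp (continuous_apply l)) _

theorem rootDegree_self (Q : IrregularType n p) (i : Fin (n + 1)) : rootDegree Q i i = 0 := by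
  have : rootPoly Q i i = 0 := Finset.sum_eq_zero fun l _ => by
    rw [(root_eq_zero_iff i i (Q l)).mpr rfl, Polynomial.monomial_zero_right]
  rw [rootDegree, this, Polynomial.natDegree_zero]

theorem rootDegree_comm (Q : IrregularType n p) (i j : Fin (n + 1)) :
    rootDegree Q i j = rootDegree Q j i := by
  have : rootPoly Q i j = -rootPoly Q j i := by
    rw [rootPoly, rootPoly, ← Finset.sum_neg_distrib]
    refine Finset.sum_congr rfl fun l _ => ?_
    rw [← Polynomial.monomial_neg]
    congr 1
    simp [root]
  rw [rootDegree, this, Polynomial.natDegree_neg, rootDegree]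

/-- The ultrametric inequality, from `α_ik = α_ij + α_jk`; it makes `SamePart` transitive. -/
theorem rootDegree_le_max (Q : IrregularType n p) (i j k : Fin (n + 1)) :
    rootDegree Q i k ≤ max (rootDegree Q i j) (rootDegree Q j k) := by
  have : rootPoly Q i k = rootPoly Q i j + rootPoly Q j k := by
    rw [rootPoly, rootPoly, rootPoly, ← Finset.sum_add_distrib]
    refine Finset.sum_congr rfl fun l _ => ?_
    rw [← map_add]
    congr 1
    simp [root]
  rw [rootDegree, this]
  exact Polynomial.natDegree_add_le _ _

theorem samePart_succ_iff (Q : IrregularType n p) (l : ℕ) (i j : Fin (n + 1)) :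
    SamePart Q (l + 1) i j ↔ rootDegree Q i j < l + 1 := by
  constructor
  · rintro (rfl | h)
    · rw [rootDegree_self]
      omega
    · exact h.2
  · intro h
    by_cases hij : i = j
    · exact Or.inl hij
    · exact Or.inr ⟨hij, h⟩

theorem SamePart.symm {Q : IrregularType n p} {l : ℕ} {i j : Fin (n + 1)}
    (h : SamePart Q (l + 1) i j) : SamePart Q (l + 1) j i := by
  rwa [samePart_succ_iff, rootDegree_comm, ← samePart_succ_iff]

theorem SamePart.trans {Q : IrregularType n p} {l : ℕ} {i j k : Fin (n + 1)}
    (h : SamePart Q (l + 1) i j) (h' : SamePart Q (l + 1) j k) : SamePart Q (l + 1) i k := by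
  rw [samePart_succ_iff] at *
  exact (rootDegree_le_max Q i j k).trans_lt (max_lt h h')

theorem SamePart.mono {Q : IrregularType n p} {l l' : ℕ} (hl : l ≤ l') {i j : Fin (n + 1)}
    (h : SamePart Q l i j) : SamePart Q l' i j :=
  h.imp_right fun h => ⟨h.1, h.2.trans_le hl⟩

theorem samePart_fissionParent (Q : IrregularType n p) (l : ℕ) (c : Fin (n + 1)) :
    SamePart Q (l + 1) c (fissionParent Q l c) := by
  classical
  exact (Finset.mem_filter.mp (Finset.min'_mem _ _)).2

theorem fissionParent_le {Q : IrregularType n p} {l : ℕ} {c b : Fin (n + 1)}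
    (h : SamePart Q (l + 1) c b) : fissionParent Q l c ≤ b := by
  classical
  exact Finset.min'_le _ _ (Finset.mem_filter.mpr ⟨Finset.mem_univ _, h⟩)

theorem fissionParent_eq_iff (Q : IrregularType n p) (l : ℕ) (c b : Fin (n + 1)) :
    fissionParent Q l c = fissionParent Q l b ↔ SamePart Q (l + 1) c b := by
  constructor
  · intro h
    exact (samePart_fissionParent Q l c).trans (h ▸ (samePart_fissionParent Q l b).symm)
  · intro h
    exact le_antisymm (fissionParent_le (h.trans (samePart_fissionParent Q l b)))
      (fissionParent_le (h.symm.trans (samePart_fissionParent Q l c)))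

/-- `fissionParent Q l` sends any index to the minimum of its class at level `l + 1`, so it also
serves as the projection onto the representatives of that level. -/
theorem mem_fissionLevel_iff (Q : IrregularType n p) (l : ℕ) (c : Fin (n + 1)) :
    c ∈ fissionLevel Q (l + 1) ↔ fissionParent Q l c = c := by
  classical
  rw [fissionLevel, Finset.mem_filter]
  constructor
  · intro h
    exact le_antisymm (fissionParent_le (Or.inl rfl)) (h.2 _ (samePart_fissionParent Q l c))
  · intro h
    exact ⟨Finset.mem_univ _, fun b hb => h ▸ fissionParent_le hb⟩

theorem fissionParent_mem_fissionLevel (Q : IrregularType n p) (l : ℕ) (c : Fin (n + 1)) :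
    fissionParent Q l c ∈ fissionLevel Q (l + 1) :=
  (mem_fissionLevel_iff Q l _).mpr
    ((fissionParent_eq_iff Q l _ _).mpr (samePart_fissionParent Q l c).symm)

theorem mem_fissionChildren_iff (Q : IrregularType n p) (l : ℕ) (b c : Fin (n + 1)) :
    b ∈ fissionChildren Q l c ↔ b ∈ fissionLevel Q l ∧ fissionParent Q l b = c :=
  Finset.mem_filter

end Levels

/-! ### Child-nodes and the blocks they form. -/

section Children

variable {m : ℕ}

/-- The child-nodes in `J_l` of a list of nodes in `J_{l + 1}`, listed from left to right. -/
noncomputable def childNode (Q : IrregularType n p) (l : ℕ) (node : Fin m → Fin (n + 1))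
    (a : (i : Fin m) × Fin (fissionChildren Q l (node i)).card) : Fin (n + 1) :=
  (fissionChildren Q l (node a.1)).orderEmbOfFin rfl a.2

theorem childNode_mem (Q : IrregularType n p) (l : ℕ) (node : Fin m → Fin (n + 1))
    (a : (i : Fin m) × Fin (fissionChildren Q l (node i)).card) :
    childNode Q l node a ∈ fissionLevel Q l ∧
      fissionParent Q l (childNode Q l node a) = node a.1 :=
  (mem_fissionChildren_iff Q l _ _).mp (Finset.orderEmbOfFin_mem _ _ _)

theorem childNode_injective (Q : IrregularType n p) (l : ℕ) (node : Fin m → Fin (n + 1))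
    (hnode : Function.Injective node) : Function.Injective (childNode Q l node) := by
  rintro ⟨i, a⟩ ⟨j, b⟩ h
  obtain rfl : i = j := hnode (by
    rw [← (childNode_mem Q l node ⟨i, a⟩).2, ← (childNode_mem Q l node ⟨j, b⟩).2, h])
  obtain rfl : a = b := (Finset.orderEmbOfFin _ _).injective h
  rfl

theorem exists_childNode_eq (Q : IrregularType n p) (l : ℕ) (node : Fin m → Fin (n + 1))
    (hnode : ∀ c ∈ fissionLevel Q (l + 1), ∃ i, node i = c) (c : Fin (n + 1))
    (hc : c ∈ fissionLevel Q l) : ∃ a, childNode Q l node a = c := by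
  obtain ⟨i, hi⟩ := hnode _ (fissionParent_mem_fissionLevel Q l c)
  have h : c ∈ Set.range ((fissionChildren Q l (node i)).orderEmbOfFin rfl) := by
    rw [Finset.range_orderEmbOfFin]
    exact (mem_fissionChildren_iff Q l _ _).mpr ⟨hc, hi.symm⟩
  obtain ⟨a, ha⟩ := h
  exact ⟨⟨i, a⟩, ha⟩

theorem one_le_card_fissionChildren (Q : IrregularType n p) (l : ℕ) (c : Fin (n + 1))
    (hc : c ∈ fissionLevel Q (l + 2)) : 1 ≤ (fissionChildren Q (l + 1) c).card := by
  refine Finset.card_pos.mpr ⟨c, (mem_fissionChildren_iff Q _ _ _).mpr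
    ⟨(mem_fissionLevel_iff Q l c).mpr ?_, (mem_fissionLevel_iff Q (l + 1) c).mp hc⟩⟩
  -- Classes grow with the level, so the minimum of a class is also the minimum of its own smaller
  -- class: `c` is a child of itself.
  refine le_antisymm (fissionParent_le (Or.inl rfl)) ?_
  conv_lhs => rw [← (mem_fissionLevel_iff Q (l + 1) c).mp hc]
  exact fissionParent_le ((samePart_fissionParent Q l c).mono (by omega))

/-- The indices of the nodes in `J_{l + 1}` that contain the elements of `{1, …, n + 1}`. -/
theorem exists_childIndex (Q : IrregularType n p) (l : ℕ) (node : Fin m → Fin (n + 1))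
    (hinj : Function.Injective node) (hnode : ∀ c ∈ fissionLevel Q (l + 2), ∃ i, node i = c) :
    ∃ idx : Fin (n + 1) → (i : Fin m) × Fin (fissionChildren Q (l + 1) (node i)).card,
      (∀ a, idx (childNode Q (l + 1) node a) = a) ∧
      (∀ x y, rootDegree Q x y < l + 1 ↔ idx x = idx y) ∧
      (∀ x y, rootDegree Q x y < l + 2 ↔ (idx x).1 = (idx y).1) := by
  choose idx hidx using fun x => exists_childNode_eq Q (l + 1) node hnode _
    (fissionParent_mem_fissionLevel Q l x)
  have hchild := childNode_injective Q (l + 1) node hinj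
  refine ⟨idx, fun a => hchild ?_, fun x y => ?_, fun x y => ?_⟩
  · rw [hidx]
    exact (mem_fissionLevel_iff Q l _).mp (childNode_mem Q (l + 1) node a).1
  · rw [← hchild.eq_iff, hidx, hidx, fissionParent_eq_iff, samePart_succ_iff]
  -- The block of `x` is given by the parent of the child-node containing `x`, that is, by the class
  -- of `x` one level higher.
  · have h : ∀ x, node (idx x).1 = fissionParent Q (l + 1) x := by
      intro x
      rw [← (childNode_mem Q (l + 1) node (idx x)).2, hidx, fissionParent_eq_iff]
      exact (samePart_fissionParent Q l x).symm.mono (by omega)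
    rw [← hinj.eq_iff, h, h, fissionParent_eq_iff, samePart_succ_iff]

end Children

/-! ### Coefficient spaces as products of configuration spaces. -/

section LevelSpace

variable {m : ℕ} {k : Fin m → ℕ}

/-- The mean of the coordinates of a vector with coordinates taken from a family of
configurations. -/
noncomputable def confMean (idx : Fin (n + 1) → (i : Fin m) × Fin (k i)) (y : ∀ i, Conf (k i)) :
    ℂ :=
  (∑ x, (y (idx x).1).1 (idx x).2) / (n + 1)

theorem continuous_point (i : Fin m) (a : Fin (k i)) :
    Continuous fun y : ∀ i, Conf (k i) => (y i).1 a :=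
  (continuous_apply a).comp (continuous_subtype_val.comp (continuous_apply i))

theorem continuous_confMean (idx : Fin (n + 1) → (i : Fin m) × Fin (k i)) :
    Continuous (confMean idx) :=
  (continuous_finsetSum _ fun x _ => continuous_point (idx x).1 (idx x).2).div_const _

/-- The space of the coefficients of `x ^ l` is homotopy equivalent to a product of configuration
spaces: coordinates with the same index agree, and coordinates with distinct indices in the same
block are distinct. -/
noncomputable def levelSpaceEquiv (Q : IrregularType n p) (l : ℕ)
    (idx : Fin (n + 1) → (i : Fin m) × Fin (k i)) (child : (i : Fin m) × Fin (k i) → Fin (n + 1))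
    (hidx : ∀ a, idx (child a) = a) (h1 : ∀ x y, rootDegree Q x y < l ↔ idx x = idx y)
    (h2 : ∀ x y, rootDegree Q x y < l + 1 ↔ (idx x).1 = (idx y).1) :
    ContinuousMap.HomotopyEquiv (levelSpace Q l) (∀ i, Conf (k i)) where
  toFun :=
    { toFun := fun v i => ⟨fun a => v.1.1 (child ⟨i, a⟩), fun a b hab => by
        have h : idx (child ⟨i, a⟩) ≠ idx (child ⟨i, b⟩) := by
          rw [hidx, hidx]
          simpa using hab
        refine (v.2 _ _ fun h' => h (congrArg idx h')).2 ?_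
        -- Distinct indices in the same block force the degree to be exactly `l`, which is when the
        -- coordinates must differ.
        have h3 := mt (h1 _ _).mp h
        have h4 := (h2 (child ⟨i, a⟩) (child ⟨i, b⟩)).mpr (by rw [hidx, hidx])
        omega⟩
      continuous_toFun := by
        refine continuous_pi fun i => Continuous.subtype_mk (continuous_pi fun a => ?_) _
        exact (continuous_apply (child ⟨i, a⟩)).comp
          (continuous_subtype_val.comp continuous_subtype_val) }
  invFun :=
    { toFun := fun y => ⟨⟨fun x => (y (idx x).1).1 (idx x).2 - confMean idx y, by
        change ∑ x, ((y (idx x).1).1 (idx x).2 - confMean idx y) = 0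
        have : (n + 1 : ℂ) ≠ 0 := Nat.cast_add_one_ne_zero n
        rw [Finset.sum_sub_distrib, Finset.sum_const, Finset.card_univ, Fintype.card_fin,
          nsmul_eq_mul, confMean]
        push_cast
        field_simp
        ring⟩, fun x x' hx => by
          refine ⟨fun h => ?_, fun h h' => ?_⟩
          · change _ - _ = _ - _
            rw [(h1 x x').mp h]
          · have h3 := (h2 x x').mp (by omega)
            have h4 : idx x ≠ idx x' := fun h5 => by
              have := (h1 x x').mpr h5
              omega
            have h6 := sub_left_injective h'
            revert h3 h4 h6
            generalize idx x = q
            generalize idx x' = q'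
            obtain ⟨i, a⟩ := q
            obtain ⟨i', a'⟩ := q'
            rintro rfl h4 h6
            exact (y i).2 a a' (fun h => h4 (by rw [h])) h6⟩
      continuous_toFun := by
        refine Continuous.subtype_mk (Continuous.subtype_mk (continuous_pi fun x => ?_) _) _
        exact (continuous_point _ _).sub (continuous_confMean idx) }
  -- This composite equals the identity: a vector of the Cartan subalgebra already has mean zero.
  left_inv := by
    refine ⟨ContinuousMap.Homotopy.refl _ |>.cast (ContinuousMap.ext fun v => ?_) rfl⟩
    have hv : ∀ x, v.1.1 (child (idx x)) = v.1.1 x := by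
      intro x
      by_cases hx : child (idx x) = x
      · rw [hx]
      · exact (v.2 _ _ hx).1 ((h1 _ _).mpr (hidx _))
    refine Subtype.ext (Subtype.ext (funext fun x => ?_))
    change v.1.1 x = v.1.1 (child (idx x)) - (∑ x, v.1.1 (child (idx x))) / (n + 1)
    simp_rw [hv]
    rw [show ∑ x, v.1.1 x = 0 from v.1.2]
    simp
  -- This composite subtracts the common mean from all blocks; scaling the translation down to zero
  -- creates no collision inside a block.
  right_inv := ⟨{
    toFun := fun w i => ⟨fun a => (w.2 i).1 a - ((1 - w.1 : ℝ) : ℂ) * confMean idx w.2,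
      fun a b hab h => (w.2 i).2 a b hab (sub_left_injective h)⟩
    continuous_toFun := by
      refine continuous_pi fun i => Continuous.subtype_mk (continuous_pi fun a => ?_) _
      have h3 : Continuous fun w : unitInterval × (∀ i, Conf (k i)) => (w.2 i).1 a :=
        (continuous_point i a).comp continuous_snd
      have h4 : Continuous fun w : unitInterval × (∀ i, Conf (k i)) => confMean idx w.2 :=
        (continuous_confMean idx).comp continuous_snd
      fun_prop
    map_zero_left := fun y => by
      refine funext fun i => Subtype.ext (funext fun a => ?_)
      change _ = (y (idx (child ⟨i, a⟩)).1).1 (idx (child ⟨i, a⟩)).2 - _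
      rw [hidx]
      simp
    map_one_left := fun y => by
      refine funext fun i => Subtype.ext (funext fun a => ?_)
      simp }⟩

end LevelSpace

/-! ### Induction over the stages, and comparison of the two products. -/

section Stages

/-- The list of the nodes in the lowest level of `fissionStage Q d`. -/
noncomputable def stageNode (Q : IrregularType n p) (d : ℕ) : Fin (fissionStage Q d).1 → Fin (n + 1) :=
  (fissionStage Q d).2.2

/-- The product of the pure braid groups of the nodes in the lowest level of
`fissionStage Q d`. -/
abbrev StageGroup (Q : IrregularType n p) (d : ℕ) : Type :=
  ∀ i, PB (fissionChildren Q (p - d) (stageNode Q d i)).card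

theorem stageNode_spec (Q : IrregularType n p) (d : ℕ) (hd : d ≤ p) :
    Function.Injective (stageNode Q d) ∧
      ∀ c, c ∈ fissionLevel Q (p - d + 1) ↔ ∃ i, stageNode Q d i = c := by
  induction d with
  | zero =>
    refine ⟨fun i j _ => Subsingleton.elim (α := Fin 1) i j, fun c => ?_⟩
    -- All degrees are at most `p`, so level `p + 1` is a single class, with minimum `0`.
    have h : fissionParent Q p c = 0 :=
      le_antisymm (fissionParent_le ((samePart_succ_iff Q p c 0).mpr
        (Nat.lt_succ_of_le (rootDegree_le Q c 0)))) (Fin.zero_le _)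
    rw [Nat.sub_zero, mem_fissionLevel_iff, h]
    exact ⟨fun h => ⟨(0 : Fin 1), h⟩, fun ⟨_, h⟩ => h⟩
  | succ d ih =>
    obtain ⟨h1, h2⟩ := ih (by omega)
    have h3 : p - (d + 1) + 1 = p - d := by omega
    have h4 : stageNode Q (d + 1) =
      childNode Q (p - d) (stageNode Q d) ∘ finSigmaFinEquiv.symm := rfl
    rw [h3, h4]
    refine ⟨(childNode_injective Q _ _ h1).comp finSigmaFinEquiv.symm.injective, fun c => ?_⟩
    constructor
    · intro hc
      obtain ⟨a, ha⟩ := exists_childNode_eq Q _ _ (fun c hc => (h2 c).mp hc) c hc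
      exact ⟨finSigmaFinEquiv a, (congrArg _ (Equiv.symm_apply_apply _ a)).trans ha⟩
    · rintro ⟨a, rfl⟩
      exact (childNode_mem Q _ _ _).1

theorem nonempty_levelSpace_mulEquiv_stageGroup (Q : IrregularType n p) (d l : ℕ)
    (h : p - d = l + 1) (v : levelSpace Q (l + 1)) :
    Nonempty (FundamentalGroup (levelSpace Q (l + 1)) v ≃* StageGroup Q d) := by
  obtain ⟨h1, h2⟩ := stageNode_spec Q d (by omega)
  unfold StageGroup
  rw [h] at h2 ⊢
  obtain ⟨idx, h3, h4, h5⟩ := exists_childIndex Q l (stageNode Q d) h1 fun c hc => (h2 c).mp hc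
  -- The image of `v` need not be the standard configuration; path connectedness allows the change
  -- of base point.
  exact ⟨((fundamentalGroupEquivOfHomotopyEquiv (levelSpaceEquiv Q (l + 1) idx _ h3 h4 h5) v).trans
    (FundamentalGroup.fundamentalGroupMulEquivOfPathConnected _ _)).trans
      (fundamentalGroupPi fun i => stdConf _).symm⟩

theorem isCabledBraidGroup_fissionStage (Q : IrregularType n p) (d : ℕ) (hd : d ≤ p) :
    IsCabledBraidGroup (∀ e : Fin d, StageGroup Q e) (fissionStage Q d).2.1 := by
  induction d with
  | zero => exact isCabledBraidGroup_root _
  | succ d ih =>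
    obtain ⟨_, h2⟩ := stageNode_spec Q d (by omega)
    have hk : ∀ i, 1 ≤ (fissionChildren Q (p - d) (stageNode Q d i)).card := by
      intro i
      obtain ⟨l, hl⟩ : ∃ l, p - d = l + 1 := ⟨p - d - 1, by omega⟩
      rw [hl] at h2 ⊢
      exact one_le_card_fissionChildren Q l _ ((h2 _).mpr ⟨i, rfl⟩)
    exact ((ih (by omega)).grow _ hk).congr
      { toFun := fun u => (fun e => u e.castSucc, u (Fin.last d))
        invFun := fun w => Fin.snoc (α := fun e : Fin (d + 1) => StageGroup Q e) w.1 w.2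
        left_inv := fun u => Fin.snoc_init_self u
        right_inv := fun w => Prod.ext
          (funext fun e =>
            Fin.snoc_castSucc (α := fun e : Fin (d + 1) => StageGroup Q e) w.2 w.1 e)
          (Fin.snoc_last (α := fun e : Fin (d + 1) => StageGroup Q e) w.2 w.1)
        map_mul' := fun _ _ => rfl }

theorem isCabledBraidGroup_fissionTree (Q : IrregularType n p) :
    IsCabledBraidGroup (WMCG Q) (fissionTree Q) := by
  -- Stage `d` adds level `p - d`, while index `l` stands for the coefficient of `x ^ (l + 1)`; so
  -- `d = p - 1 - l`, whence the order reversal.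
  have g : ∀ l : Fin p, ∀ v : levelSpace Q (l + 1),
      FundamentalGroup (levelSpace Q (l + 1)) v ≃* StageGroup Q (Fin.revPerm l) := fun l v =>
    (nonempty_levelSpace_mulEquiv_stageGroup Q _ l
      (by rw [Fin.revPerm_apply, Fin.val_rev]; omega) v).some
  have e : (∀ l : Fin p, StageGroup Q (Fin.revPerm l)) ≃* ∀ d : Fin p, StageGroup Q d :=
    (MulEquiv.symm
      { (Equiv.piCongrLeft (fun d : Fin p => StageGroup Q d) Fin.revPerm).symm with
        map_mul' := fun _ _ => rfl })
  exact (isCabledBraidGroup_fissionStage Q p le_rfl).congr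
    ((((fundamentalGroupEquivOfHomotopyEquiv
      (deformationSpaceHomeomorph Q).toHomotopyEquiv _).trans (fundamentalGroupPi _).symm).trans
        (MulEquiv.piCongrRight fun l => g l _)).trans e)

end Stages

end CabledBraids

theorem mainTheorem8 :
    -- the operadic composition is a group homomorphism, injective if no strand is deleted
    (∀ (n : ℕ) (k : Fin n → ℕ),
      (∀ a b : PB n × (∀ i, PB (k i)),
        CabledBraids.γ (a * b) = CabledBraids.γ a * CabledBraids.γ b) ∧
      ((∀ i, 1 ≤ k i) →
        Function.Injective (CabledBraids.γ : PB n × (∀ i, PB (k i)) → PB (∑ i, k i)))) ∧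
    -- the pure cabled braid group of the fission tree is a subgroup isomorphic to `Γ_Q`
    (∀ (n p : ℕ) (Q : IrregularType n p),
      ∃ H : Subgroup (PB (leafCount Q)),
        (H : Set (PB (leafCount Q))) = cabledBraids (fissionTree Q) ∧
        Nonempty (WMCG Q ≃* H)) :=
  ⟨fun _ _ => ⟨CabledBraids.γ_mul, CabledBraids.γ_injective⟩,
    fun _ _ Q => CabledBraids.isCabledBraidGroup_fissionTree Q⟩
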